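/- For $n\ge 2$ let $\mathcal U(n)$ be the Brown algebra, i.e. the universal unital C*-algebra generated by elements $u_{ij}$ ($1\le i,j\le n$) subject to the relations $\sum_{k}u_{ik}u_{lk}^*=\delta_{il}1$ and $\sum_{i}u_{ik}^*u_{il}=\delta_{kl}1$ (so that $(u_{ij})$ is a unitary matrix). Write $u_{ij}$ and $v_{ij}$ for the generators of two copies of $\mathcal U(n)$. Let $\rho=\sum_{a,b,c,d}\rho_{abcd}\,E_{ab}\otimes E_{cd}\in M_n(\mathbb C)\otimes M_n(\mathbb C)$ be any density matrix (positive semidefinite of trace one), where $E_{ab}$ are the matrix units, and put $$x^{\rho}_{jkrs}=\sum_{l,i,t,p=1}^n\rho_{litp}\,u_{ij}u_{lk}^*\otimes v_{pr}v_{ts}^*\qquad(1\le j,k,r,s\le n).$$ Let $\mathcal F_{qc}^{\rho}\subset\mathcal U(n)\otimes_{\max}\mathcal U(n)$ and $\mathcal F_{qa}^{\rho}\subset\mathcal U(n)\otimes_{\min}\mathcal U(n)$ be the operator systems given by the linear span of $1\otimes 1$ and the elements $x^\rho_{jkrs}$ in the respective C*-algebra. A state on an operator system is a unital linear functional that is nonnegative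 on those of its elements that are positive in the ambient C*-algebra; $S(\cdot)$ denotes the set of states. Then $S(\mathcal F_{qc}^{\rho})=S(\mathcal F_{qa}^{\rho})$. Precisely: the canonical *-homomorphism $\mathcal U(n)\otimes_{\max}\mathcal U(n)\to\mathcal U(n)\otimes_{\min}\mathcal U(n)$, which is the identity on the algebraic tensor product, restricts to a linear bijection $\kappa:\mathcal F_{qc}^{\rho}\to\mathcal F_{qa}^{\rho}$, and under this identification the two state spaces coincide: $S(\mathcal F_{qc}^{\rho})=\{\psi\circ\kappa:\psi\in S(\mathcal F_{qa}^{\rho})\}$. -/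

import Mathlib

open scoped TensorProduct ComplexOrder

noncomputable section

namespace BrownTsirelson

/-- The free unital complex *-algebra on a set `X`, realised on the free algebra with one generator
`Sum.inl x` for each `x` and one generator `Sum.inr x` for its adjoint. -/
def FreeStarAlgebra (X : Type*) : Type _ := FreeAlgebra ℂ (X ⊕ X)

namespace FreeStarAlgebra

variable (X : Type*)

instance : Ring (FreeStarAlgebra X) := inferInstanceAs (Ring (FreeAlgebra ℂ (X ⊕ X)))
instance : Algebra ℂ (FreeStarAlgebra X) := inferInstanceAs (Algebra ℂ (FreeAlgebra ℂ (X ⊕ X)))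

/-- The opposite of the free algebra, with scalars acting through complex conjugation. -/
def ConjOp : Type _ := (FreeAlgebra ℂ (X ⊕ X))ᵐᵒᵖ

instance : Ring (ConjOp X) := inferInstanceAs (Ring (FreeAlgebra ℂ (X ⊕ X))ᵐᵒᵖ)

instance : Algebra ℂ (ConjOp X) :=
  ((algebraMap ℂ (FreeAlgebra ℂ (X ⊕ X))ᵐᵒᵖ).comp (starRingEnd ℂ)).toAlgebra'
    (fun c x => Algebra.commutes (starRingEnd ℂ c) x)

/-- The conjugate-linear anti-homomorphism exchanging `x` and its adjoint. -/
def starHom : FreeAlgebra ℂ (X ⊕ X) →+* (FreeAlgebra ℂ (X ⊕ X))ᵐᵒᵖ :=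
  (FreeAlgebra.lift ℂ (A := ConjOp X)
    (fun y => MulOpposite.op (FreeAlgebra.ι ℂ y.swap))).toRingHom

variable {X}

theorem starHom_ι (y : X ⊕ X) :
    starHom X (FreeAlgebra.ι ℂ y) = MulOpposite.op (FreeAlgebra.ι ℂ y.swap) :=
  FreeAlgebra.lift_ι_apply (R := ℂ) (A := ConjOp X) _ y

theorem starHom_algebraMap (c : ℂ) :
    starHom X (algebraMap ℂ _ c) = MulOpposite.op (algebraMap ℂ _ (starRingEnd ℂ c)) :=
  AlgHom.commutes (B := ConjOp X) _ c

theorem starHom_starHom (a : FreeAlgebra ℂ (X ⊕ X)) :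
    (starHom X (starHom X a).unop).unop = a := by
  induction a using FreeAlgebra.induction with
  | grade0 r => simp [starHom_algebraMap]
  | grade1 x => simp [starHom_ι]
  | mul a b ha hb => simp [ha, hb]
  | add a b ha hb => simp [ha, hb]

instance : StarRing (FreeStarAlgebra X) where
  star a := (starHom X a).unop
  star_involutive a := starHom_starHom a
  star_mul a b := by
    change (starHom X (show FreeAlgebra ℂ (X ⊕ X) from a * b)).unop = _
    exact congrArg MulOpposite.unop (map_mul (starHom X) a b)
  star_add a b := congrArg MulOpposite.unop (map_add (starHom X) a b)

instance : StarModule ℂ (FreeStarAlgebra X) where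
  star_smul c a := by
    have h (b : FreeAlgebra ℂ (X ⊕ X)) :
        (starHom X (algebraMap ℂ (FreeAlgebra ℂ (X ⊕ X)) c * b)).unop =
        algebraMap ℂ (FreeAlgebra ℂ (X ⊕ X)) (star c) * (starHom X b).unop := by
      rw [map_mul, starHom_algebraMap, MulOpposite.unop_mul, MulOpposite.unop_op]
      exact (Algebra.commutes _ _).symm
    rw [Algebra.smul_def, Algebra.smul_def]
    exact h a

/-- The generators of the free *-algebra. -/
def gen (x : X) : FreeStarAlgebra X := FreeAlgebra.ι ℂ (Sum.inl x)

theorem star_gen (x : X) : star (gen x) = (FreeAlgebra.ι ℂ (Sum.inr x) : FreeAlgebra ℂ (X ⊕ X)) :=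
  congrArg MulOpposite.unop (starHom_ι (Sum.inl x))

theorem induction {motive : FreeStarAlgebra X → Prop}
    (scalar : ∀ c : ℂ, motive (algebraMap ℂ (FreeStarAlgebra X) c))
    (gen : ∀ x, motive (gen x)) (star_gen : ∀ x, motive (star (FreeStarAlgebra.gen x)))
    (mul : ∀ a b, motive a → motive b → motive (a * b))
    (add : ∀ a b, motive a → motive b → motive (a + b)) (a : FreeStarAlgebra X) : motive a := by
  refine FreeAlgebra.induction (R := ℂ) (X := X ⊕ X) (motive := motive) scalar ?_ mul add a
  rintro (x | x)
  · exact gen x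
  · rw [← FreeStarAlgebra.star_gen]; exact star_gen x

variable {A : Type*} [Ring A] [StarRing A] [Algebra ℂ A] [StarModule ℂ A]

/-- The universal property: any family `f` in a *-algebra extends to a *-homomorphism. -/
def lift (f : X → A) : FreeStarAlgebra X →⋆ₐ[ℂ] A where
  __ := (FreeAlgebra.lift ℂ (Sum.elim f (fun x => star (f x))) : FreeAlgebra ℂ (X ⊕ X) →ₐ[ℂ] A)
  map_star' a := by
    let F : FreeStarAlgebra X →ₐ[ℂ] A :=
      (FreeAlgebra.lift ℂ (Sum.elim f (fun x => star (f x))) : FreeAlgebra ℂ (X ⊕ X) →ₐ[ℂ] A)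
    change F (star a) = star (F a)
    have h1 (x : X) : F (gen x) = f x := by
      simp only [F, gen]
      exact FreeAlgebra.lift_ι_apply _ _
    have h2 (x : X) : F (star (gen x)) = star (f x) := by
      rw [star_gen]
      exact FreeAlgebra.lift_ι_apply _ _
    induction a using induction with
    | scalar c =>
      rw [← algebraMap_star_comm, AlgHom.commutes, AlgHom.commutes, algebraMap_star_comm]
    | gen x => rw [h1, h2]
    | star_gen x => rw [star_star, h1, h2, star_star]
    | mul a b ha hb => rw [star_mul, map_mul, ha, hb, map_mul, star_mul]
    | add a b ha hb => rw [star_add, map_add, ha, hb, map_add, star_add]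

@[simp] theorem lift_gen (f : X → A) (x : X) : lift f (gen x) = f x :=
  FreeAlgebra.lift_ι_apply (R := ℂ) (Sum.elim f (fun x => star (f x))) (Sum.inl x)

attribute [irreducible] starHom

end FreeStarAlgebra

/-- A C*-seminorm on a unital complex *-algebra. -/
structure CStarSeminorm (𝒜 : Type*) [Ring 𝒜] [StarRing 𝒜] [Algebra ℂ 𝒜] where
  toFun : 𝒜 → ℝ
  add_le' : ∀ x y, toFun (x + y) ≤ toFun x + toFun y
  smul' : ∀ (c : ℂ) x, toFun (c • x) = ‖c‖ * toFun x
  mul_le' : ∀ x y, toFun (x * y) ≤ toFun x * toFun y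
  star_mul_self' : ∀ x, toFun (star x * x) = toFun x * toFun x

namespace CStarSeminorm

variable {𝒜 : Type*} [Ring 𝒜] [StarRing 𝒜] [Algebra ℂ 𝒜]

instance : CoeFun (CStarSeminorm 𝒜) (fun _ => 𝒜 → ℝ) := ⟨toFun⟩

theorem apply_zero (p : CStarSeminorm 𝒜) : p 0 = 0 := by simpa using p.smul' 0 0

theorem apply_neg (p : CStarSeminorm 𝒜) (x : 𝒜) : p (-x) = p x := by
  simpa using p.smul' (-1) x

theorem nonneg (p : CStarSeminorm 𝒜) (x : 𝒜) : 0 ≤ p x := by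
  have h := p.add_le' x (-x)
  rw [add_neg_cancel, p.apply_zero, p.apply_neg] at h
  linarith

theorem apply_star (p : CStarSeminorm 𝒜) (x : 𝒜) : p (star x) = p x := by
  have key (y : 𝒜) : p y ≤ p (star y) := by
    have h := p.mul_le' (star y) y
    rw [p.star_mul_self'] at h
    rcases (p.nonneg y).eq_or_lt with h0 | h0
    · rw [← h0]; exact p.nonneg _
    · exact le_of_mul_le_mul_right h h0
  refine le_antisymm ?_ (key x)
  simpa using key (star x)

/-- The pointwise supremum of a pointwise bounded family of C*-seminorms. -/
def sup {ι : Type*} (q : ι → CStarSeminorm 𝒜) (hq : ∀ x, BddAbove (Set.range fun i => q i x)) :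
    CStarSeminorm 𝒜 where
  toFun x := ⨆ i, q i x
  add_le' x y := by
    refine Real.iSup_le (fun i => ((q i).add_le' x y).trans ?_)
      (add_nonneg (Real.iSup_nonneg fun i => (q i).nonneg x) (Real.iSup_nonneg fun i => (q i).nonneg y))
    exact add_le_add (le_ciSup (hq x) i) (le_ciSup (hq y) i)
  smul' c x := by simp only [smul', Real.mul_iSup_of_nonneg (norm_nonneg c)]
  mul_le' x y := by
    refine Real.iSup_le (fun i => ((q i).mul_le' x y).trans ?_)
      (mul_nonneg (Real.iSup_nonneg fun i => (q i).nonneg x) (Real.iSup_nonneg fun i => (q i).nonneg y))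
    exact mul_le_mul (le_ciSup (hq x) i) (le_ciSup (hq y) i) ((q i).nonneg y)
      (Real.iSup_nonneg fun i => (q i).nonneg x)
  star_mul_self' x := by
    simp only [star_mul_self']
    have h0 : 0 ≤ ⨆ i, q i x := Real.iSup_nonneg fun i => (q i).nonneg x
    apply le_antisymm
    · refine Real.iSup_le (fun i => ?_) (mul_nonneg h0 h0)
      exact mul_le_mul (le_ciSup (hq x) i) (le_ciSup (hq x) i) ((q i).nonneg x) h0
    · have hb : BddAbove (Set.range fun i => q i x * q i x) := by
        obtain ⟨C, hC⟩ := hq x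
        refine ⟨C * C, ?_⟩
        rintro _ ⟨i, rfl⟩
        have := hC ⟨i, rfl⟩
        exact mul_le_mul this this ((q i).nonneg x) (((q i).nonneg x).trans this)
      rw [← sq, ← Real.le_sqrt h0 (Real.iSup_nonneg fun i => mul_self_nonneg _)]
      refine Real.iSup_le (fun i => ?_) (Real.sqrt_nonneg _)
      exact Real.le_sqrt_of_sq_le (by rw [sq]; exact le_ciSup hb i)

theorem le_sup {ι : Type*} (q : ι → CStarSeminorm 𝒜)
    (hq : ∀ x, BddAbove (Set.range fun i => q i x)) (i : ι) (x : 𝒜) : q i x ≤ sup q hq x :=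
  le_ciSup (hq x) i

/-- The C*-seminorm `x ↦ ‖f x‖` of a *-homomorphism into a C*-algebra. -/
def ofHom {C : Type*} [CStarAlgebra C] (f : 𝒜 →⋆ₐ[ℂ] C) : CStarSeminorm 𝒜 where
  toFun x := ‖f x‖
  add_le' x y := by rw [map_add]; exact norm_add_le _ _
  smul' c x := by rw [map_smul, norm_smul]
  mul_le' x y := by rw [map_mul]; exact norm_mul_le _ _
  star_mul_self' x := by rw [map_mul, map_star, CStarRing.norm_star_mul_self]

/-- The underlying *-algebra, regarded as a seminormed algebra by means of `p`. -/
def Pre (_p : CStarSeminorm 𝒜) : Type _ := 𝒜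

variable (p : CStarSeminorm 𝒜)

instance : Ring p.Pre := inferInstanceAs (Ring 𝒜)
instance : StarRing p.Pre := inferInstanceAs (StarRing 𝒜)
instance : Algebra ℂ p.Pre := inferInstanceAs (Algebra ℂ 𝒜)
instance [StarModule ℂ 𝒜] : StarModule ℂ p.Pre := inferInstanceAs (StarModule ℂ 𝒜)

instance : Norm p.Pre := ⟨p.toFun⟩

instance : SeminormedAddCommGroup p.Pre :=
  SeminormedAddCommGroup.ofCore (𝕜 := ℂ)
    { norm_nonneg := p.nonneg
      norm_smul := p.smul'
      norm_triangle := p.add_le' }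

instance : SeminormedRing p.Pre where
  __ := (inferInstance : Ring p.Pre)
  __ := (inferInstance : SeminormedAddCommGroup p.Pre)
  norm_mul_le := p.mul_le'

theorem norm_def (x : p.Pre) : ‖x‖ = p x := rfl

instance : NormedAlgebra ℂ p.Pre where
  norm_smul_le c x := (p.smul' c x).le

instance : NormedStarGroup p.Pre where
  norm_star_le x := (p.apply_star x).le

section CompletionInstances

open UniformSpace.Completion

theorem norm_coe' (x : p.Pre) : ‖(x : UniformSpace.Completion p.Pre)‖ = p x := norm_coe x

instance : NormedAlgebra ℂ (UniformSpace.Completion p.Pre) where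
  norm_smul_le c a := norm_smul_le c a

instance : Star (UniformSpace.Completion p.Pre) :=
  ⟨UniformSpace.Completion.map (fun x : p.Pre => star x)⟩

theorem coe_star (x : p.Pre) :
    ((star x : p.Pre) : UniformSpace.Completion p.Pre) = star (x : UniformSpace.Completion p.Pre) :=
  (UniformSpace.Completion.map_coe (star_isometry (E := p.Pre)).uniformContinuous x).symm

instance : ContinuousStar (UniformSpace.Completion p.Pre) :=
  ⟨UniformSpace.Completion.continuous_map⟩

instance : StarRing (UniformSpace.Completion p.Pre) where
  star_involutive a := by
    induction a using UniformSpace.Completion.induction_on with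
    | hp => exact isClosed_eq continuous_star.star continuous_id
    | ih x => rw [← coe_star, ← coe_star, star_star]
  star_mul a b := by
    induction a, b using UniformSpace.Completion.induction_on₂ with
    | hp =>
      exact isClosed_eq (continuous_fst.mul continuous_snd).star
        (continuous_snd.star.mul continuous_fst.star)
    | ih x y => rw [← coe_mul, ← coe_star, ← coe_star, ← coe_star, star_mul, coe_mul]
  star_add a b := by
    induction a, b using UniformSpace.Completion.induction_on₂ with
    | hp =>
      exact isClosed_eq (continuous_fst.add continuous_snd).star
        (continuous_fst.star.add continuous_snd.star)
    | ih x y => rw [← coe_add, ← coe_star, ← coe_star, ← coe_star, star_add, coe_add]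

instance : CStarRing (UniformSpace.Completion p.Pre) where
  norm_mul_self_le a := by
    induction a using UniformSpace.Completion.induction_on with
    | hp =>
      exact isClosed_le (continuous_norm.mul continuous_norm)
        (continuous_star.mul continuous_id).norm
    | ih x =>
      rw [← coe_star, ← coe_mul, norm_coe', norm_coe']
      exact (p.star_mul_self' x).ge

instance [StarModule ℂ 𝒜] : StarModule ℂ (UniformSpace.Completion p.Pre) where
  star_smul c a := by
    induction a using UniformSpace.Completion.induction_on with
    | hp =>
      exact isClosed_eq (continuous_const_smul c).star
        ((continuous_const_smul (star c)).comp continuous_star)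
    | ih x => rw [← coe_smul, ← coe_star, ← coe_star, star_smul, coe_smul]

end CompletionInstances

theorem continuous_pre {C : Type*} [CStarAlgebra C] (f : 𝒜 →⋆ₐ[ℂ] C) (hf : ∀ x, ‖f x‖ ≤ p x) :
    Continuous (show p.Pre →+* C from (f : 𝒜 →+* C)) :=
  AddMonoidHomClass.continuous_of_bound (show p.Pre →+* C from (f : 𝒜 →+* C)) 1
    (fun x => by rw [one_mul]; exact hf x)

variable [StarModule ℂ 𝒜]

/-- The C*-algebra obtained by separated completion of a *-algebra in a C*-seminorm. -/
def Completion : Type _ := UniformSpace.Completion p.Pre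

instance Completion.cstarAlgebra : CStarAlgebra p.Completion where
  __ := (inferInstance : NormedRing (UniformSpace.Completion p.Pre))
  __ := (inferInstance : StarRing (UniformSpace.Completion p.Pre))
  __ := (inferInstance : CompleteSpace (UniformSpace.Completion p.Pre))
  __ := (inferInstance : CStarRing (UniformSpace.Completion p.Pre))
  __ := (inferInstance : NormedAlgebra ℂ (UniformSpace.Completion p.Pre))
  __ := (inferInstance : StarModule ℂ (UniformSpace.Completion p.Pre))

namespace Completion

/-- The canonical *-homomorphism into the completion. -/
def of : 𝒜 →⋆ₐ[ℂ] p.Completion where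
  toFun x := @UniformSpace.Completion.coe' p.Pre inferInstance x
  map_one' := rfl
  map_mul' x y := UniformSpace.Completion.coe_mul (α := p.Pre) x y
  map_zero' := rfl
  map_add' x y := UniformSpace.Completion.coe_add (α := p.Pre) x y
  commutes' _ := rfl
  map_star' x := coe_star p x

theorem norm_of (x : 𝒜) : ‖of p x‖ = p x := norm_coe' p x

theorem denseRange_of : DenseRange (of p) :=
  UniformSpace.Completion.denseRange_coe (α := p.Pre)

variable {p} in
theorem induction {motive : p.Completion → Prop} (hc : IsClosed {a | motive a})
    (h : ∀ x, motive (of p x)) (a : p.Completion) : motive a :=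
  UniformSpace.Completion.induction_on a hc h

variable {p} {C : Type*} [CStarAlgebra C] (f : 𝒜 →⋆ₐ[ℂ] C)

/-- The ring homomorphism underlying `lift`. -/
def liftRingHom (hf : ∀ x, ‖f x‖ ≤ p x) : p.Completion →+* C :=
  UniformSpace.Completion.extensionHom (show p.Pre →+* C from (f : 𝒜 →+* C)) (continuous_pre p f hf)

theorem continuous_liftRingHom (hf : ∀ x, ‖f x‖ ≤ p x) : Continuous (liftRingHom f hf) :=
  UniformSpace.Completion.continuous_extension

theorem liftRingHom_of (hf : ∀ x, ‖f x‖ ≤ p x) (x : 𝒜) : liftRingHom f hf (of p x) = f x :=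
  UniformSpace.Completion.extensionHom_coe (show p.Pre →+* C from (f : 𝒜 →+* C))
    (continuous_pre p f hf) x

/-- The extension to the completion of a *-homomorphism dominated by the seminorm. -/
def lift (hf : ∀ x, ‖f x‖ ≤ p x) : p.Completion →⋆ₐ[ℂ] C where
  toFun := liftRingHom f hf
  map_one' := map_one _
  map_mul' := map_mul _
  map_zero' := map_zero _
  map_add' := map_add _
  commutes' c := (liftRingHom_of f hf (algebraMap ℂ 𝒜 c)).trans (AlgHomClass.commutes f c)
  map_star' a := by
    induction a using induction with
    | hc =>
      exact isClosed_eq ((continuous_liftRingHom f hf).comp continuous_star)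
        (continuous_liftRingHom f hf).star
    | h x => rw [← map_star, liftRingHom_of, liftRingHom_of, map_star]

@[simp] theorem lift_of (hf : ∀ x, ‖f x‖ ≤ p x) (x : 𝒜) : lift f hf (of p x) = f x :=
  liftRingHom_of f hf x

end Completion

attribute [irreducible] Completion Completion.cstarAlgebra Completion.of Completion.lift

end CStarSeminorm

/-- A unital *-representation on a complex Hilbert space. -/
structure StarRep.{u, v} (𝒜 : Type v) [Ring 𝒜] [StarRing 𝒜] [Algebra ℂ 𝒜] where
  H : Type u
  [normed : NormedAddCommGroup H]
  [inner : InnerProductSpace ℂ H]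
  [complete : CompleteSpace H]
  π : 𝒜 →⋆ₐ[ℂ] (H →L[ℂ] H)

attribute [instance] StarRep.normed StarRep.inner StarRep.complete

theorem norm_one_le (H : Type*) [NormedAddCommGroup H] [InnerProductSpace ℂ H] :
    ‖(1 : H →L[ℂ] H)‖ ≤ 1 := ContinuousLinearMap.norm_id_le

section Brown

/-- The defining relations of the Brown algebra: the matrix `u` is unitary. -/
structure BrownRelations {A : Type*} [Ring A] [StarRing A] {n : ℕ} (u : Fin n → Fin n → A) :
    Prop where
  mul_star : ∀ i l, ∑ k, u i k * star (u l k) = if i = l then 1 else 0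
  star_mul : ∀ k l, ∑ i, star (u i k) * u i l = if k = l then 1 else 0

/-- The generators of the free *-algebra on an `n × n` matrix of symbols. -/
def freeGen {n : ℕ} (i j : Fin n) : FreeStarAlgebra (Fin n × Fin n) := FreeStarAlgebra.gen (i, j)

/-- The *-representations of the free *-algebra that satisfy the Brown relations. -/
abbrev BrownRep (n : ℕ) : Type 1 :=
  {ϖ : StarRep.{0} (FreeStarAlgebra (Fin n × Fin n)) //
    BrownRelations fun i j => ϖ.π (freeGen i j)}

theorem BrownRelations.norm_le {H : Type*} [NormedAddCommGroup H] [InnerProductSpace ℂ H]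
    [CompleteSpace H] {n : ℕ} {u : Fin n → Fin n → H →L[ℂ] H} (h : BrownRelations u)
    (i j : Fin n) : ‖u i j‖ ≤ 1 := by
  refine ContinuousLinearMap.opNorm_le_bound _ zero_le_one fun x => ?_
  have h1 := congrArg (fun T : H →L[ℂ] H => RCLike.re (inner ℂ x (T x))) (h.star_mul j j)
  simp only [if_true, sum_apply, inner_sum, map_sum,
    mul_apply_eq_comp, ContinuousLinearMap.star_eq_adjoint,
    ContinuousLinearMap.adjoint_inner_right, one_apply_eq_self,
    inner_self_eq_norm_sq] at h1
  have h2 : ‖u i j x‖ ^ 2 ≤ ‖x‖ ^ 2 := by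
    rw [← h1]
    exact Finset.single_le_sum (f := fun k => ‖u k j x‖ ^ 2) (fun _ _ => sq_nonneg _)
      (Finset.mem_univ i)
  rw [one_mul]
  exact (sq_le_sq₀ (norm_nonneg _) (norm_nonneg _)).1 h2

theorem brown_bdd {n : ℕ} (x : FreeStarAlgebra (Fin n × Fin n)) :
    ∃ C, ∀ ϖ : BrownRep n, ‖ϖ.1.π x‖ ≤ C := by
  induction x using FreeStarAlgebra.induction with
  | scalar c =>
    refine ⟨‖c‖, fun ϖ => ?_⟩
    rw [AlgHomClass.commutes, Algebra.algebraMap_eq_smul_one, norm_smul]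
    exact mul_le_of_le_one_right (norm_nonneg c) (norm_one_le _)
  | gen x => exact ⟨1, fun ϖ => ϖ.2.norm_le x.1 x.2⟩
  | star_gen x =>
    refine ⟨1, fun ϖ => ?_⟩
    rw [map_star, norm_star]
    exact ϖ.2.norm_le x.1 x.2
  | mul a b ha hb =>
    obtain ⟨C, hC⟩ := ha
    obtain ⟨D, hD⟩ := hb
    refine ⟨C * D, fun ϖ => ?_⟩
    rw [map_mul]
    exact (norm_mul_le _ _).trans
      (mul_le_mul (hC ϖ) (hD ϖ) (norm_nonneg _) ((norm_nonneg _).trans (hC ϖ)))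
  | add a b ha hb =>
    obtain ⟨C, hC⟩ := ha
    obtain ⟨D, hD⟩ := hb
    refine ⟨C + D, fun ϖ => ?_⟩
    rw [map_add]
    exact (norm_add_le _ _).trans (add_le_add (hC ϖ) (hD ϖ))

/-- The universal C*-seminorm: the supremum of `‖π x‖` over all representations of the relations. -/
def brownSeminorm (n : ℕ) : CStarSeminorm (FreeStarAlgebra (Fin n × Fin n)) :=
  CStarSeminorm.sup (fun ϖ : BrownRep n => CStarSeminorm.ofHom ϖ.1.π) fun x => by
    obtain ⟨C, hC⟩ := brown_bdd x
    exact ⟨C, by rintro _ ⟨ϖ, rfl⟩; exact hC ϖ⟩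

/-- The Brown algebra `𝒰(n)`: the universal unital C*-algebra generated by the entries of a
unitary `n × n` matrix. -/
abbrev BrownAlgebra (n : ℕ) : Type := (brownSeminorm n).Completion

/-- The canonical generators `u i j` of the Brown algebra. -/
def brownGen {n : ℕ} (i j : Fin n) : BrownAlgebra n :=
  CStarSeminorm.Completion.of (brownSeminorm n) (freeGen i j)

/-- The generators of the Brown algebra form a unitary matrix. -/
theorem brownGen_relations (n : ℕ) :
    BrownRelations fun i j : Fin n => (brownGen i j : BrownAlgebra n) := by
  have key (x y : FreeStarAlgebra (Fin n × Fin n)) (h : ∀ ϖ : BrownRep n, ϖ.1.π x = ϖ.1.π y) :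
      CStarSeminorm.Completion.of (brownSeminorm n) x =
        CStarSeminorm.Completion.of (brownSeminorm n) y := by
    rw [← sub_eq_zero, ← map_sub, ← norm_eq_zero, CStarSeminorm.Completion.norm_of]
    refine le_antisymm (Real.iSup_le (fun ϖ => ?_) le_rfl) (CStarSeminorm.nonneg _ _)
    change ‖ϖ.1.π (x - y)‖ ≤ 0
    rw [map_sub, h, sub_self, norm_zero]
  constructor
  · intro i l
    have h := key (∑ k, freeGen i k * star (freeGen l k)) (algebraMap ℂ _ (if i = l then 1 else 0))
      fun ϖ => by
        have h1 := ϖ.2.mul_star i l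
        simp only [← map_star, ← map_mul, ← map_sum] at h1
        rw [h1, AlgHomClass.commutes]
        split_ifs <;> simp
    rw [AlgHomClass.commutes] at h
    simp only [map_sum, map_mul, map_star] at h
    refine h.trans ?_
    split_ifs <;> simp
  · intro k l
    have h := key (∑ i, star (freeGen i k) * freeGen i l) (algebraMap ℂ _ (if k = l then 1 else 0))
      fun ϖ => by
        have h1 := ϖ.2.star_mul k l
        simp only [← map_star, ← map_mul, ← map_sum] at h1
        rw [h1, AlgHomClass.commutes]
        split_ifs <;> simp
    rw [AlgHomClass.commutes] at h
    simp only [map_sum, map_mul, map_star] at h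
    refine h.trans ?_
    split_ifs <;> simp

/-- The universal property of the Brown algebra, for unitary matrices of operators. -/
theorem exists_brown_lift {H : Type} [NormedAddCommGroup H] [InnerProductSpace ℂ H]
    [CompleteSpace H] {n : ℕ} (u : Fin n → Fin n → H →L[ℂ] H) (hu : BrownRelations u) :
    ∃ f : BrownAlgebra n →⋆ₐ[ℂ] (H →L[ℂ] H), ∀ i j, f (brownGen i j) = u i j := by
  let g : FreeStarAlgebra (Fin n × Fin n) →⋆ₐ[ℂ] (H →L[ℂ] H) :=
    FreeStarAlgebra.lift fun x => u x.1 x.2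
  have hg (i j : Fin n) : g (freeGen i j) = u i j := FreeStarAlgebra.lift_gen _ _
  let ϖ : BrownRep n := ⟨⟨H, g⟩, by simpa only [hg] using hu⟩
  refine ⟨CStarSeminorm.Completion.lift g
    (CStarSeminorm.le_sup (fun ϖ : BrownRep n => CStarSeminorm.ofHom ϖ.1.π) _ ϖ), fun i j => ?_⟩
  exact (CStarSeminorm.Completion.lift_of g _ _).trans (hg i j)

end Brown

section Hilbert

variable {H K : Type*} [NormedAddCommGroup H] [InnerProductSpace ℂ H]
  [NormedAddCommGroup K] [InnerProductSpace ℂ K]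

/-- The Hilbert space tensor product. -/
abbrev HilbertTensor (H K : Type*) [NormedAddCommGroup H] [InnerProductSpace ℂ H]
    [NormedAddCommGroup K] [InnerProductSpace ℂ K] : Type _ :=
  UniformSpace.Completion (H ⊗[ℂ] K)

/-- The operator `S ⊗ T` on the Hilbert space tensor product. -/
def opTensor (S : H →L[ℂ] H) (T : K →L[ℂ] K) : HilbertTensor H K →L[ℂ] HilbertTensor H K :=
  (TensorProduct.mapL S T).completion

theorem opTensor_coe (S : H →L[ℂ] H) (T : K →L[ℂ] K) (x : H ⊗[ℂ] K) :
    opTensor S T (x : HilbertTensor H K) = (TensorProduct.mapL S T x : H ⊗[ℂ] K) :=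
  ContinuousLinearMap.completion_apply_coe _ _

theorem hilbertTensor_ext {S T : HilbertTensor H K →L[ℂ] HilbertTensor H K}
    (h : ∀ x : H ⊗[ℂ] K, S (x : HilbertTensor H K) = T (x : HilbertTensor H K)) : S = T := by
  ext y
  induction y using UniformSpace.Completion.induction_on with
  | hp => exact isClosed_eq S.continuous T.continuous
  | ih x => exact h x

theorem opTensor_mul (S S' : H →L[ℂ] H) (T T' : K →L[ℂ] K) :
    opTensor (S * S') (T * T') = opTensor S T * opTensor S' T' :=
  hilbertTensor_ext fun x => by
    rw [mul_apply_eq_comp, opTensor_coe, opTensor_coe, opTensor_coe,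
      TensorProduct.mapL_mul, mul_apply_eq_comp]

theorem opTensor_one : opTensor (1 : H →L[ℂ] H) (1 : K →L[ℂ] K) = 1 :=
  hilbertTensor_ext fun x => by
    rw [opTensor_coe]
    exact congrArg _ (congrArg (fun f => f x) TensorProduct.mapL_id_id)

theorem opTensor_add_left (S S' : H →L[ℂ] H) (T : K →L[ℂ] K) :
    opTensor (S + S') T = opTensor S T + opTensor S' T :=
  hilbertTensor_ext fun x => by
    rw [add_apply, opTensor_coe, opTensor_coe, opTensor_coe, TensorProduct.mapL_add_left, add_apply,
      UniformSpace.Completion.coe_add]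

theorem opTensor_add_right (S : H →L[ℂ] H) (T T' : K →L[ℂ] K) :
    opTensor S (T + T') = opTensor S T + opTensor S T' :=
  hilbertTensor_ext fun x => by
    rw [add_apply, opTensor_coe, opTensor_coe, opTensor_coe, TensorProduct.mapL_add_right,
      add_apply, UniformSpace.Completion.coe_add]

theorem opTensor_smul_left (c : ℂ) (S : H →L[ℂ] H) (T : K →L[ℂ] K) :
    opTensor (c • S) T = c • opTensor S T :=
  hilbertTensor_ext fun x => by
    rw [smul_apply, opTensor_coe, opTensor_coe, TensorProduct.mapL_smul_left, smul_apply,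
      UniformSpace.Completion.coe_smul]

theorem opTensor_smul_right (c : ℂ) (S : H →L[ℂ] H) (T : K →L[ℂ] K) :
    opTensor S (c • T) = c • opTensor S T :=
  hilbertTensor_ext fun x => by
    rw [smul_apply, opTensor_coe, opTensor_coe, TensorProduct.mapL_smul_right, smul_apply,
      UniformSpace.Completion.coe_smul]

variable [CompleteSpace H] [CompleteSpace K]

theorem inner_mapL (S : H →L[ℂ] H) (T : K →L[ℂ] K) (x y : H ⊗[ℂ] K) :
    inner ℂ (TensorProduct.mapL (star S) (star T) x) y = inner ℂ x (TensorProduct.mapL S T y) := by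
  induction x with
  | zero => simp
  | add a b ha hb => rw [map_add, inner_add_left, inner_add_left, ha, hb]
  | tmul a b =>
    induction y with
    | zero => simp
    | add c d hc hd => rw [map_add, inner_add_right, inner_add_right, hc, hd]
    | tmul c d =>
      rw [TensorProduct.mapL_tmul, TensorProduct.mapL_tmul, TensorProduct.inner_tmul,
        TensorProduct.inner_tmul, ContinuousLinearMap.star_eq_adjoint,
        ContinuousLinearMap.star_eq_adjoint, ContinuousLinearMap.adjoint_inner_left,
        ContinuousLinearMap.adjoint_inner_left]

theorem opTensor_star (S : H →L[ℂ] H) (T : K →L[ℂ] K) :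
    opTensor (star S) (star T) = star (opTensor S T) := by
  rw [ContinuousLinearMap.star_eq_adjoint (A := opTensor S T), ContinuousLinearMap.eq_adjoint_iff]
  intro x y
  induction x, y using UniformSpace.Completion.induction_on₂ with
  | hp => exact isClosed_eq (by fun_prop) (by fun_prop)
  | ih x y =>
    rw [opTensor_coe, opTensor_coe, UniformSpace.Completion.inner_coe,
      UniformSpace.Completion.inner_coe, inner_mapL]

end Hilbert

section TensorProducts

variable {A B : Type*} [CStarAlgebra A] [CStarAlgebra B]

open CStarSeminorm

/-- The *-homomorphism `a ↦ a ⊗ 1`. -/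
def tmulLeft : A →⋆ₐ[ℂ] A ⊗[ℂ] B where
  __ := (Algebra.TensorProduct.includeLeft : A →ₐ[ℂ] A ⊗[ℂ] B)
  map_star' a := by simp

/-- The *-homomorphism `b ↦ 1 ⊗ b`. -/
def tmulRight : B →⋆ₐ[ℂ] A ⊗[ℂ] B where
  __ := (Algebra.TensorProduct.includeRight : B →ₐ[ℂ] A ⊗[ℂ] B)
  map_star' b := by simp

theorem tmulLeft_mul_tmulRight (a : A) (b : B) :
    (tmulLeft a : A ⊗[ℂ] B) * tmulRight b = a ⊗ₜ b := by
  change (a ⊗ₜ[ℂ] (1 : B)) * ((1 : A) ⊗ₜ[ℂ] b) = _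
  rw [Algebra.TensorProduct.tmul_mul_tmul, mul_one, one_mul]

theorem norm_rep_tmul_le (ϖ : StarRep (A ⊗[ℂ] B)) (a : A) (b : B) :
    ‖ϖ.π (a ⊗ₜ b)‖ ≤ ‖a‖ * ‖b‖ := by
  rw [← tmulLeft_mul_tmulRight, map_mul]
  exact (norm_mul_le _ _).trans
    (mul_le_mul (NonUnitalStarAlgHom.norm_apply_le (ϖ.π.comp tmulLeft) a)
      (NonUnitalStarAlgHom.norm_apply_le (ϖ.π.comp tmulRight) b) (norm_nonneg _) (norm_nonneg _))

theorem rep_bdd (x : A ⊗[ℂ] B) :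
    ∃ C, ∀ ϖ : StarRep (A ⊗[ℂ] B), ‖ϖ.π x‖ ≤ C := by
  induction x with
  | zero => exact ⟨0, fun ϖ => by simp⟩
  | tmul a b => exact ⟨‖a‖ * ‖b‖, fun ϖ => norm_rep_tmul_le ϖ a b⟩
  | add a b ha hb =>
    obtain ⟨C, hC⟩ := ha
    obtain ⟨D, hD⟩ := hb
    refine ⟨C + D, fun ϖ => ?_⟩
    rw [map_add]
    exact (norm_add_le _ _).trans (add_le_add (hC ϖ) (hD ϖ))

end TensorProducts

section MaxMin

universe u

variable {A B : Type u} [CStarAlgebra A] [CStarAlgebra B]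

/-- The representation `π ⊗ σ` of the algebraic tensor product on the Hilbert space tensor
product. -/
def StarRep.tensor (ϖ : StarRep.{u} A) (σ : StarRep.{u} B) : StarRep.{u} (A ⊗[ℂ] B) where
  H := HilbertTensor ϖ.H σ.H
  π :=
    { Algebra.TensorProduct.lift (S := ℂ)
        ({ toFun := fun a => opTensor (ϖ.π a) 1
           map_one' := by rw [map_one, opTensor_one]
           map_mul' := fun a b => by rw [map_mul, ← opTensor_mul, mul_one]
           map_zero' := by simpa using opTensor_smul_left 0 (0 : ϖ.H →L[ℂ] ϖ.H) (1 : σ.H →L[ℂ] σ.H)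
           map_add' := fun a b => by rw [map_add, opTensor_add_left]
           commutes' := fun c => by
            rw [AlgHomClass.commutes, Algebra.algebraMap_eq_smul_one,
              Algebra.algebraMap_eq_smul_one, opTensor_smul_left, opTensor_one] } :
          A →ₐ[ℂ] (HilbertTensor ϖ.H σ.H →L[ℂ] HilbertTensor ϖ.H σ.H))
        { toFun := fun b => opTensor 1 (σ.π b)
          map_one' := by rw [map_one, opTensor_one]
          map_mul' := fun a b => by rw [map_mul, ← opTensor_mul, mul_one]
          map_zero' := by simpa using opTensor_smul_right 0 (1 : ϖ.H →L[ℂ] ϖ.H) (0 : σ.H →L[ℂ] σ.H)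
          map_add' := fun a b => by rw [map_add, opTensor_add_right]
          commutes' := fun c => by
            rw [AlgHomClass.commutes, Algebra.algebraMap_eq_smul_one,
              Algebra.algebraMap_eq_smul_one, opTensor_smul_right, opTensor_one] }
        (fun a b => by
          change opTensor _ _ * opTensor _ _ = opTensor _ _ * opTensor _ _
          rw [← opTensor_mul, ← opTensor_mul, mul_one, mul_one, one_mul, one_mul]) with
      map_star' := fun x => by
        induction x with
        | zero => simp
        | add a b ha hb => simpa using! congrArg₂ (· + ·) ha hb
        | tmul a b =>
          change opTensor (ϖ.π (star a)) 1 * opTensor 1 (σ.π (star b)) =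
            star (opTensor (ϖ.π a) 1 * opTensor 1 (σ.π b))
          rw [← opTensor_mul, ← opTensor_mul, ← opTensor_star, mul_one, one_mul, map_star,
            map_star, mul_one, one_mul] }

theorem StarRep.tensor_tmul (ϖ : StarRep.{u} A) (σ : StarRep.{u} B) (a : A) (b : B) :
    (ϖ.tensor σ).π (a ⊗ₜ b) = opTensor (ϖ.π a) (σ.π b) := by
  change opTensor (ϖ.π a) 1 * opTensor 1 (σ.π b) = _
  rw [← opTensor_mul, mul_one, one_mul]

variable (A B)

/-- The maximal C*-norm on the algebraic tensor product: the supremum of `‖π x‖` over all its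
*-representations `π`. -/
def maxSeminorm : CStarSeminorm (A ⊗[ℂ] B) :=
  CStarSeminorm.sup (fun ϖ : StarRep.{u} (A ⊗[ℂ] B) => CStarSeminorm.ofHom ϖ.π) fun x => by
    obtain ⟨C, hC⟩ := rep_bdd x
    exact ⟨C, by rintro _ ⟨ϖ, rfl⟩; exact hC ϖ⟩

/-- The minimal (spatial) C*-norm on the algebraic tensor product: the supremum of
`‖(π ⊗ σ) x‖` over all *-representations `π` of `A` and `σ` of `B`. -/
def minSeminorm : CStarSeminorm (A ⊗[ℂ] B) :=
  CStarSeminorm.sup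
    (fun ϖσ : StarRep.{u} A × StarRep.{u} B => CStarSeminorm.ofHom (ϖσ.1.tensor ϖσ.2).π)
    fun x => by
      obtain ⟨C, hC⟩ := rep_bdd x
      exact ⟨C, by rintro _ ⟨ϖσ, rfl⟩; exact hC _⟩

theorem minSeminorm_le_maxSeminorm (x : A ⊗[ℂ] B) : minSeminorm A B x ≤ maxSeminorm A B x :=
  Real.iSup_le
    (fun ϖσ => CStarSeminorm.le_sup (fun ϖ : StarRep.{u} (A ⊗[ℂ] B) => CStarSeminorm.ofHom ϖ.π)
      _ (ϖσ.1.tensor ϖσ.2) x)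
    (CStarSeminorm.nonneg _ x)

/-- The maximal tensor product `A ⊗_max B`. -/
abbrev MaxTensor : Type u := (maxSeminorm A B).Completion

/-- The minimal tensor product `A ⊗_min B`. -/
abbrev MinTensor : Type u := (minSeminorm A B).Completion

/-- The canonical map of the algebraic tensor product into `A ⊗_max B`. -/
abbrev toMax : A ⊗[ℂ] B →⋆ₐ[ℂ] MaxTensor A B := CStarSeminorm.Completion.of (maxSeminorm A B)

/-- The canonical map of the algebraic tensor product into `A ⊗_min B`. -/
abbrev toMin : A ⊗[ℂ] B →⋆ₐ[ℂ] MinTensor A B := CStarSeminorm.Completion.of (minSeminorm A B)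

/-- The canonical *-homomorphism `A ⊗_max B → A ⊗_min B`, the identity on the algebraic tensor
product. -/
def maxToMin : MaxTensor A B →⋆ₐ[ℂ] MinTensor A B :=
  CStarSeminorm.Completion.lift (toMin A B) fun x => by
    rw [CStarSeminorm.Completion.norm_of]
    exact minSeminorm_le_maxSeminorm A B x

theorem maxToMin_toMax (x : A ⊗[ℂ] B) : maxToMin A B (toMax A B x) = toMin A B x :=
  CStarSeminorm.Completion.lift_of _ _ x

end MaxMin

section OperatorSystems

/-- A (concrete) operator system in a unital C*-algebra: a self-adjoint subspace containing `1`. -/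
structure OperatorSystem (A : Type*) [CStarAlgebra A] extends Submodule ℂ A where
  one_mem' : (1 : A) ∈ carrier
  star_mem' : ∀ {x : A}, x ∈ carrier → star x ∈ carrier

/-- A state on an operator system `S ⊆ A`: a linear functional that maps `1` to `1` and is
nonnegative on the elements of `S` that are positive in `A`. -/
structure IsState {A : Type*} [CStarAlgebra A] (S : OperatorSystem A)
    (φ : S.toSubmodule →ₗ[ℂ] ℂ) : Prop where
  map_one : φ ⟨1, S.one_mem'⟩ = 1
  nonneg : ∀ x : S.toSubmodule, (∃ y : A, (x : A) = star y * y) → 0 ≤ φ x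

/-- The state space of an operator system. -/
def stateSpace {A : Type*} [CStarAlgebra A] (S : OperatorSystem A) :
    Set (S.toSubmodule →ₗ[ℂ] ℂ) := {φ | IsState S φ}

/-- `ρ` is a density matrix in `M_n(ℂ) ⊗ M_n(ℂ)`. The coefficient `ρ_{abcd}` of `ρ` at
`E_ab ⊗ E_cd` is the matrix entry `ρ (a, c) (b, d)`. -/
structure IsDensityMatrix {n : ℕ} (ρ : Matrix (Fin n × Fin n) (Fin n × Fin n) ℂ) : Prop where
  posSemidef : ρ.PosSemidef
  trace_eq_one : ρ.trace = 1

variable {n : ℕ} (ρ : Matrix (Fin n × Fin n) (Fin n × Fin n) ℂ)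

/-- The element `∑_{l,i,t,p} ρ_{litp} u_ij u_lk^* ⊗ v_pr v_ts^*`. -/
def weighted (j k r s : Fin n) : BrownAlgebra n ⊗[ℂ] BrownAlgebra n :=
  ∑ l, ∑ i, ∑ t, ∑ p, ρ (l, t) (i, p) •
    ((brownGen i j * star (brownGen l k)) ⊗ₜ[ℂ] (brownGen p r * star (brownGen t s)))

variable {ρ}

theorem star_weighted (hρ : IsDensityMatrix ρ) (j k r s : Fin n) :
    star (weighted ρ j k r s) = weighted ρ k j s r := by
  simp only [weighted, star_sum, star_smul, TensorProduct.star_tmul, star_mul, star_star]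
  rw [Finset.sum_comm]
  refine Finset.sum_congr rfl fun i _ => Finset.sum_congr rfl fun l _ => ?_
  rw [Finset.sum_comm]
  refine Finset.sum_congr rfl fun p _ => Finset.sum_congr rfl fun t _ => ?_
  rw [hρ.posSemidef.isHermitian.apply]

/-- The operator system spanned by `1` and the elements `weighted ρ j k r s`, inside a C*-algebra
`C` into which the algebraic tensor product `𝒰(n) ⊗ 𝒰(n)` is mapped. -/
def weightedSystem {C : Type*} [CStarAlgebra C] (e : BrownAlgebra n ⊗[ℂ] BrownAlgebra n →⋆ₐ[ℂ] C)
    (hρ : IsDensityMatrix ρ) : OperatorSystem C where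
  __ := Submodule.span ℂ ({1} ∪ {x | ∃ j k r s, x = e (weighted ρ j k r s)})
  one_mem' := Submodule.subset_span (Or.inl rfl)
  star_mem' {x} hx := by
    refine Submodule.span_induction (p := fun x _ => star x ∈
      Submodule.span ℂ ({1} ∪ {x | ∃ j k r s, x = e (weighted ρ j k r s)})) ?_ ?_ ?_ ?_ hx
    · rintro x (rfl | ⟨j, k, r, s, rfl⟩)
      · rw [star_one]; exact Submodule.subset_span (Or.inl rfl)
      · rw [← map_star, star_weighted hρ]
        exact Submodule.subset_span (Or.inr ⟨k, j, s, r, rfl⟩)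
    · rw [star_zero]; exact Submodule.zero_mem _
    · intro x y _ _ hx hy; rw [star_add]; exact Submodule.add_mem _ hx hy
    · intro c x _ hx; rw [star_smul]; exact Submodule.smul_mem _ _ hx

/-- The operator system `ℱ_qc^ρ ⊆ 𝒰(n) ⊗_max 𝒰(n)`. -/
def Fqc (hρ : IsDensityMatrix ρ) : OperatorSystem (MaxTensor (BrownAlgebra n) (BrownAlgebra n)) :=
  weightedSystem (toMax _ _) hρ

/-- The operator system `ℱ_qa^ρ ⊆ 𝒰(n) ⊗_min 𝒰(n)`. -/
def Fqa (hρ : IsDensityMatrix ρ) : OperatorSystem (MinTensor (BrownAlgebra n) (BrownAlgebra n)) :=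
  weightedSystem (toMin _ _) hρ

theorem maxToMin_mem (hρ : IsDensityMatrix ρ) {x : MaxTensor (BrownAlgebra n) (BrownAlgebra n)}
    (hx : x ∈ (Fqc hρ).toSubmodule) : maxToMin _ _ x ∈ (Fqa hρ).toSubmodule := by
  refine Submodule.span_induction
    (p := fun x _ => maxToMin _ _ x ∈ (Fqa hρ).toSubmodule) ?_ ?_ ?_ ?_ hx
  · rintro x (rfl | ⟨j, k, r, s, rfl⟩)
    · rw [map_one]; exact (Fqa hρ).one_mem'
    · rw [maxToMin_toMax]
      exact Submodule.subset_span (Or.inr ⟨j, k, r, s, rfl⟩)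
  · rw [map_zero]; exact Submodule.zero_mem _
  · intro x y _ _ hx hy; rw [map_add]; exact Submodule.add_mem _ hx hy
  · intro c x _ hx; rw [map_smul]; exact Submodule.smul_mem _ _ hx

/-- The canonical map `ℱ_qc^ρ → ℱ_qa^ρ`, which is the identity on `1 ⊗ 1` and on the elements
`∑ ρ_{litp} u_ij u_lk^* ⊗ v_pr v_ts^*`. -/
def comparison (hρ : IsDensityMatrix ρ) : (Fqc hρ).toSubmodule →ₗ[ℂ] (Fqa hρ).toSubmodule :=
  ((maxToMin (BrownAlgebra n) (BrownAlgebra n)).toAlgHom.toLinearMap).restrict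
    fun _ hx => maxToMin_mem hρ hx

end OperatorSystems

end BrownTsirelson


end

/-! Both operator systems are copies of the matrix algebra $M_n\otimes M_n=B(\mathbb
C^n\otimes\mathbb C^n)$ with its usual order, the element $x_{jkrs}$ corresponding to $E_{jk}\otimes
E_{rs}$. No difference between the maximal and the minimal norm can then be seen on them.

From matrices to the maximal tensor product: group the indices in pairs and put $U=u\otimes v$, so
that $x_{ab}=\sum_{l,i}\rho_{li}U_{ia}U_{lb}^*$. Since $\sum_a U_{ia}U_{la}^*=\delta_{il}$ and
$\operatorname{tr}\rho=1$, one gets $\sum_a x_{aa}=1$ (`sum_weighted_self`), so the linear map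
$\Phi:E_{ab}\mapsto x_{ab}$ (`ofOperator`) is unital. Writing $\rho=B^*B$ turns every form
$\sum_{a,b}\bar c_a c_b x_{ab}$ into a sum of squares (`exists_weighted_quadratic_eq`). A positive
matrix is a sum of matrices $(\bar c_a c_b)$, so $\Phi$ is positive
(`exists_ofOperator_star_mul_self`).

From the minimal tensor product back to matrices: the flip, $u_{ij}=E_{ji}$, is a unitary matrix
over $M_n$. Used in both legs it gives a *-homomorphism $\theta$ with
$\theta(x_{jkrs})=E_{jk}\otimes E_{rs}$ (`exists_minTensor_hom_weighted`), again because
$\operatorname{tr}\rho=1$.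

Hence $\Phi\circ\theta\circ\kappa=\mathrm{id}$. As $\kappa$ is onto, it is bijective with inverse
$\Phi\circ\theta$, and both $\kappa$ and this inverse are unital and positive. Composition with them
therefore exchanges the two state spaces. -/

namespace BrownTsirelson

/-! ### Matrix units and the flip unitary -/

section MatrixUnits

/-- The matrix unit `E_jk` as an operator on `ℂⁿ`. -/
noncomputable def matrixUnit {n : ℕ} (j k : Fin n) :
    EuclideanSpace ℂ (Fin n) →L[ℂ] EuclideanSpace ℂ (Fin n) :=
  InnerProductSpace.rankOne ℂ (EuclideanSpace.single j (1 : ℂ)) (EuclideanSpace.single k (1 : ℂ))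

variable {n : ℕ}

theorem star_matrixUnit (j k : Fin n) : star (matrixUnit j k) = matrixUnit k j := by
  rw [matrixUnit, ContinuousLinearMap.star_eq_adjoint, InnerProductSpace.adjoint_rankOne, matrixUnit]

theorem matrixUnit_single (j k l : Fin n) :
    matrixUnit j k (EuclideanSpace.single l (1 : ℂ)) =
      if k = l then EuclideanSpace.single j (1 : ℂ) else 0 := by
  rw [matrixUnit, InnerProductSpace.rankOne_apply, EuclideanSpace.inner_single_left]
  simp

theorem matrixUnit_mul_matrixUnit (j k l m : Fin n) :
    matrixUnit j k * matrixUnit l m = if k = l then matrixUnit j m else 0 := by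
  rw [ContinuousLinearMap.mul_def]
  conv_lhs => rw [matrixUnit, matrixUnit]
  rw [InnerProductSpace.rankOne_comp_rankOne, EuclideanSpace.inner_single_left]
  by_cases h : k = l <;> simp [h, matrixUnit]

theorem sum_matrixUnit_self : ∑ k : Fin n, matrixUnit k k = 1 := by
  have h := (EuclideanSpace.basisFun (Fin n) ℂ).sum_rankOne_eq_id
  simp only [EuclideanSpace.basisFun_apply] at h
  exact h

/-- The matrix with entries `u i j = E_ji`, that is, the flip on `ℂⁿ ⊗ ℂⁿ`, is unitary. -/
theorem brownRelations_flip : BrownRelations fun i j : Fin n => matrixUnit j i := by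
  constructor
  · intro i l
    -- $E_{ki}E_{lk}=\delta_{il}E_{kk}$, and the $E_{kk}$ sum to the identity. The column relation
    -- is the same with $E_{ik}E_{li}$ replaced by $E_{ki}E_{il}=E_{kl}$-type products summed over
    -- the repeated outer index.
    simp only [star_matrixUnit, matrixUnit_mul_matrixUnit]
    split_ifs with h
    · exact sum_matrixUnit_self
    · simp
  · intro k l
    simp only [star_matrixUnit, matrixUnit_mul_matrixUnit]
    split_ifs with h
    · exact sum_matrixUnit_self
    · simp

/-- The bounded operators on `ℂⁿ ⊗ ℂⁿ`. -/
abbrev ProductOperators (n : ℕ) : Type :=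
  HilbertTensor (EuclideanSpace ℂ (Fin n)) (EuclideanSpace ℂ (Fin n)) →L[ℂ]
    HilbertTensor (EuclideanSpace ℂ (Fin n)) (EuclideanSpace ℂ (Fin n))

/-- The product basis vectors of `ℂⁿ ⊗ ℂⁿ`. -/
noncomputable def productBasis (a : Fin n × Fin n) :
    HilbertTensor (EuclideanSpace ℂ (Fin n)) (EuclideanSpace ℂ (Fin n)) :=
  (EuclideanSpace.single a.1 (1 : ℂ) ⊗ₜ[ℂ] EuclideanSpace.single a.2 (1 : ℂ) :
    EuclideanSpace ℂ (Fin n) ⊗[ℂ] EuclideanSpace ℂ (Fin n))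

theorem inner_productBasis (a b : Fin n × Fin n) :
    inner ℂ (productBasis a) (productBasis b) = if a = b then (1 : ℂ) else 0 := by
  rw [productBasis, productBasis, UniformSpace.Completion.inner_coe, TensorProduct.inner_tmul,
    EuclideanSpace.inner_single_left, EuclideanSpace.inner_single_left]
  by_cases h1 : a.1 = b.1 <;> by_cases h2 : a.2 = b.2 <;> simp [Prod.ext_iff, h1, h2]

theorem opTensor_matrixUnit_productBasis (a b c : Fin n × Fin n) :
    opTensor (matrixUnit a.1 b.1) (matrixUnit a.2 b.2) (productBasis c) =
      if b = c then productBasis a else 0 := by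
  rw [productBasis, opTensor_coe, TensorProduct.mapL_tmul, matrixUnit_single, matrixUnit_single]
  by_cases h1 : b.1 = c.1 <;> by_cases h2 : b.2 = c.2 <;>
    simp [Prod.ext_iff, h1, h2, productBasis]

end MatrixUnits

/-! ### The weighted elements as a quadratic expression in the product unitary -/

section Weighted

variable {n : ℕ} {ρ : Matrix (Fin n × Fin n) (Fin n × Fin n) ℂ}

/-- The entries of the product unitary `u ⊗ v`. -/
noncomputable def productGen (i j : Fin n × Fin n) : BrownAlgebra n ⊗[ℂ] BrownAlgebra n :=
  brownGen i.1 j.1 ⊗ₜ[ℂ] brownGen i.2 j.2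

/-- Pairing the index of the first leg with that of the second makes `ρ` an ordinary matrix and
$u\otimes v$ a single family $U$, so that later sums run over pairs only. -/
theorem weighted_eq_sum (a b : Fin n × Fin n) :
    weighted ρ a.1 b.1 a.2 b.2 =
      ∑ l, ∑ i, ρ l i • (productGen i a * star (productGen l b)) := by
  simp only [weighted, productGen, TensorProduct.star_tmul,
    Algebra.TensorProduct.tmul_mul_tmul, Fintype.sum_prod_type]
  refine Finset.sum_congr rfl fun l _ => ?_
  rw [Finset.sum_comm]

theorem sum_productGen_mul_star (i l : Fin n × Fin n) :
    ∑ a, productGen i a * star (productGen l a) = if i = l then 1 else 0 := by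
  have h := (brownGen_relations n).mul_star
  simp only [productGen, TensorProduct.star_tmul, Algebra.TensorProduct.tmul_mul_tmul,
    Fintype.sum_prod_type, ← TensorProduct.tmul_sum, ← TensorProduct.sum_tmul, h]
  by_cases h1 : i.1 = l.1 <;> by_cases h2 : i.2 = l.2 <;>
    simp [Prod.ext_iff, h1, h2, Algebra.TensorProduct.one_def]

/-- Orthonormality of the rows of $U$ leaves only the diagonal of `ρ`, whose sum is the trace. This
puts $1\otimes1$ in the span of the weighted elements and makes `ofOperator` unital. -/
theorem sum_weighted_self (hρ : IsDensityMatrix ρ) :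
    ∑ a : Fin n × Fin n, weighted ρ a.1 a.1 a.2 a.2 = 1 := by
  simp only [weighted_eq_sum]
  rw [Finset.sum_comm]
  have h (l : Fin n × Fin n) :
      ∑ a, ∑ i, ρ l i • (productGen i a * star (productGen l a)) =
        ρ l l • (1 : BrownAlgebra n ⊗[ℂ] BrownAlgebra n) := by
    rw [Finset.sum_comm]
    simp only [← Finset.smul_sum, sum_productGen_mul_star]
    simp
  simp only [h, ← Finset.sum_smul]
  rw [show ∑ l, ρ l l = 1 from hρ.trace_eq_one, one_smul]

end Weighted

/-! ### Positivity as a sum of squares -/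

open scoped MatrixOrder Matrix.Norms.L2Operator in
theorem exists_entries_of_posSemidef {ι : Type*} [Fintype ι] [DecidableEq ι] {M : Matrix ι ι ℂ}
    (hM : M.PosSemidef) : ∃ B : Matrix ι ι ℂ, ∀ i j, M i j = ∑ q, star (B q i) * B q j := by
  obtain ⟨B, rfl⟩ := CStarAlgebra.nonneg_iff_eq_star_mul_self.mp hM.nonneg
  exact ⟨B, fun i j => rfl⟩

/-- Sums of positive elements are positive, and a positive element of a C*-algebra is a square.
`IsState` tests positivity on a single $y^*y$, so sums of squares must be brought to that form. -/
theorem exists_sum_star_mul_self {A : Type*} [CStarAlgebra A] {ι : Type*} (s : Finset ι)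
    (y : ι → A) : ∃ z : A, ∑ q ∈ s, star (y q) * y q = star z * z := by
  let _ := CStarAlgebra.spectralOrder A
  have _ := CStarAlgebra.spectralOrderedRing A
  exact CStarAlgebra.nonneg_iff_eq_star_mul_self.mp
    (Finset.sum_nonneg fun q _ => star_mul_self_nonneg (y q))

/-! ### Matrix algebra against the two operator systems -/

section Comparison

variable {n : ℕ} {ρ : Matrix (Fin n × Fin n) (Fin n × Fin n) ℂ}

/-- With $\rho=B^*B$ the form equals $\sum_q z_q^*z_q$ for
$z_q=\sum_{b,l}\overline{B_{ql}}\,c_b\,U_{lb}^*$. This is the positivity of $\Phi$ on rank-one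
matrices, and the only place where positivity of `ρ` serves as more than self-adjointness. -/
theorem exists_weighted_quadratic_eq {C : Type*} [CStarAlgebra C]
    (e : BrownAlgebra n ⊗[ℂ] BrownAlgebra n →⋆ₐ[ℂ] C) (hρ : IsDensityMatrix ρ)
    (c : Fin n × Fin n → ℂ) :
    ∃ y : C, ∑ a : Fin n × Fin n, ∑ b : Fin n × Fin n,
      (star (c a) * c b) • e (weighted ρ a.1 b.1 a.2 b.2) = star y * y := by
  obtain ⟨B, hB⟩ := exists_entries_of_posSemidef hρ.posSemidef
  let z (q : Fin n × Fin n) : BrownAlgebra n ⊗[ℂ] BrownAlgebra n :=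
    ∑ b, ∑ l, (star (B q l) * c b) • star (productGen l b)
  obtain ⟨y, hy⟩ := exists_sum_star_mul_self Finset.univ fun q => e (z q)
  refine ⟨y, ?_⟩
  rw [← hy]
  simp only [← map_star, ← map_mul, ← map_sum, ← map_smul]
  congr 1
  have hz (q : Fin n × Fin n) : star (z q) * z q = ∑ a, ∑ b, ∑ l, ∑ i,
      (star (c a) * c b * (star (B q l) * B q i)) • (productGen i a * star (productGen l b)) := by
    simp only [z, star_sum, star_smul, star_star, star_mul, Finset.sum_mul_sum]
    refine Finset.sum_congr rfl fun a _ => ?_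
    refine Finset.sum_congr rfl fun b _ => ?_
    rw [Finset.sum_comm]
    refine Finset.sum_congr rfl fun l _ => ?_
    refine Finset.sum_congr rfl fun i _ => ?_
    rw [smul_mul_smul_comm]
    congr 1
    ring
  simp only [hz]
  -- Moving the sum over $q$ innermost lets $\sum_q\overline{B_{ql}}B_{qi}=\rho_{li}$ reassemble
  -- `ρ`.
  symm
  refine Finset.sum_comm.trans (Finset.sum_congr rfl fun a _ => ?_)
  refine Finset.sum_comm.trans (Finset.sum_congr rfl fun b _ => ?_)
  rw [weighted_eq_sum, Finset.smul_sum]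
  refine Finset.sum_comm.trans (Finset.sum_congr rfl fun l _ => ?_)
  rw [Finset.smul_sum]
  refine Finset.sum_comm.trans (Finset.sum_congr rfl fun i _ => ?_)
  rw [smul_smul, hB, Finset.mul_sum, Finset.sum_smul]

/-- The flip representation sends the weighted elements to the matrix units. -/
theorem exists_minTensor_hom_weighted (hρ : IsDensityMatrix ρ) :
    ∃ θ : MinTensor (BrownAlgebra n) (BrownAlgebra n) →⋆ₐ[ℂ] ProductOperators n,
      ∀ j k r s, θ (toMin _ _ (weighted ρ j k r s)) =
        opTensor (matrixUnit j k) (matrixUnit r s) := by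
  obtain ⟨f, hf⟩ := exists_brown_lift _ (brownRelations_flip (n := n))
  let g : BrownAlgebra n ⊗[ℂ] BrownAlgebra n →⋆ₐ[ℂ] ProductOperators n :=
    (StarRep.tensor ⟨EuclideanSpace ℂ (Fin n), f⟩ ⟨EuclideanSpace ℂ (Fin n), f⟩).π
  have hg (a b : BrownAlgebra n) : g (a ⊗ₜ[ℂ] b) = opTensor (f a) (f b) :=
    StarRep.tensor_tmul _ _ a b
  -- A tensor product of two representations is among those whose supremum is the minimal norm, so
  -- `g` extends to the minimal completion.
  have hle (x : BrownAlgebra n ⊗[ℂ] BrownAlgebra n) :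
      ‖g x‖ ≤ minSeminorm (BrownAlgebra n) (BrownAlgebra n) x :=
    CStarSeminorm.le_sup (fun ϖσ : StarRep.{0} (BrownAlgebra n) × StarRep.{0} (BrownAlgebra n) =>
      CStarSeminorm.ofHom (ϖσ.1.tensor ϖσ.2).π) _
      (⟨EuclideanSpace ℂ (Fin n), f⟩, ⟨EuclideanSpace ℂ (Fin n), f⟩) x
  clear_value g
  refine ⟨CStarSeminorm.Completion.lift (C := ProductOperators n) g hle, fun j k r s => ?_⟩
  refine (CStarSeminorm.Completion.lift_of (C := ProductOperators n) g hle _).trans ?_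
  -- $E_{ji}E_{lk}=\delta_{il}E_{jk}$: the indices summed against `ρ` are forced onto its diagonal,
  -- while $j,k$ survive as a matrix unit.
  have hunit (i j l k : Fin n) : f (brownGen i j * star (brownGen l k)) =
      if i = l then matrixUnit j k else 0 := by
    rw [map_mul, map_star, hf, hf, star_matrixUnit, matrixUnit_mul_matrixUnit]
  have h0l (T : EuclideanSpace ℂ (Fin n) →L[ℂ] EuclideanSpace ℂ (Fin n)) :
      opTensor (0 : EuclideanSpace ℂ (Fin n) →L[ℂ] EuclideanSpace ℂ (Fin n)) T = 0 := by
    simpa using opTensor_smul_left 0 (0 : EuclideanSpace ℂ (Fin n) →L[ℂ] _) T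
  have h0r (T : EuclideanSpace ℂ (Fin n) →L[ℂ] EuclideanSpace ℂ (Fin n)) :
      opTensor T (0 : EuclideanSpace ℂ (Fin n) →L[ℂ] EuclideanSpace ℂ (Fin n)) = 0 := by
    simpa using opTensor_smul_right 0 T (0 : EuclideanSpace ℂ (Fin n) →L[ℂ] _)
  have hterm (l i t p : Fin n) : g (ρ (l, t) (i, p) • ((brownGen i j * star (brownGen l k)) ⊗ₜ[ℂ]
        (brownGen p r * star (brownGen t s)))) =
      if i = l then if p = t then
        ρ (l, t) (l, t) • opTensor (matrixUnit j k) (matrixUnit r s) else 0 else 0 := by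
    rw [map_smul, hg, hunit, hunit]
    split_ifs with h1 h2
    · rw [h1, h2]
    · rw [h0r, smul_zero]
    · rw [h0l, smul_zero]
    · rw [h0l, smul_zero]
  have htr : ∑ l, ∑ t, ρ (l, t) (l, t) = 1 := by
    rw [← hρ.trace_eq_one, Matrix.trace, Fintype.sum_prod_type]
    rfl
  calc g (weighted ρ j k r s)
      = ∑ l, ∑ i, ∑ t, ∑ p, (if i = l then if p = t then
          ρ (l, t) (l, t) • opTensor (matrixUnit j k) (matrixUnit r s) else 0 else 0) := by
        simp only [weighted, map_sum, hterm]
    _ = (∑ l, ∑ t, ρ (l, t) (l, t)) • opTensor (matrixUnit j k) (matrixUnit r s) := by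
        simp [Finset.sum_ite_irrel, Finset.sum_smul]
    _ = _ := by rw [htr, one_smul]

/-- The element of `ℱ_qc^ρ` whose coefficients at the weighted elements are the matrix entries of
an operator on `ℂⁿ ⊗ ℂⁿ`. -/
noncomputable def ofOperator (hρ : IsDensityMatrix ρ) :
    ProductOperators n →ₗ[ℂ] (Fqc hρ).toSubmodule where
  toFun T := ∑ a : Fin n × Fin n, ∑ b : Fin n × Fin n,
    (inner ℂ (productBasis a) (T (productBasis b)) : ℂ) •
      ⟨toMax _ _ (weighted ρ a.1 b.1 a.2 b.2),
        Submodule.subset_span (Or.inr ⟨a.1, b.1, a.2, b.2, rfl⟩)⟩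
  map_add' S T := by
    simp only [add_apply, inner_add_right, add_smul, Finset.sum_add_distrib]
  map_smul' c T := by
    simp only [smul_apply, inner_smul_right, mul_smul, Finset.smul_sum, RingHom.id_apply]

theorem coe_ofOperator (hρ : IsDensityMatrix ρ)
    (T : ProductOperators n) :
    (ofOperator hρ T : MaxTensor (BrownAlgebra n) (BrownAlgebra n)) =
      ∑ a : Fin n × Fin n, ∑ b : Fin n × Fin n,
        (inner ℂ (productBasis a) (T (productBasis b)) : ℂ) •
          toMax _ _ (weighted ρ a.1 b.1 a.2 b.2) := by
  simp [ofOperator]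

theorem coe_ofOperator_matrixUnit (hρ : IsDensityMatrix ρ) (j k r s : Fin n) :
    (ofOperator hρ (opTensor (matrixUnit j k) (matrixUnit r s)) :
      MaxTensor (BrownAlgebra n) (BrownAlgebra n)) = toMax _ _ (weighted ρ j k r s) := by
  have h (a b : Fin n × Fin n) : inner ℂ (productBasis a)
      (opTensor (matrixUnit j k) (matrixUnit r s) (productBasis b)) =
        if (k, s) = b then if a = (j, r) then (1 : ℂ) else 0 else 0 := by
    rw [opTensor_matrixUnit_productBasis (j, r) (k, s) b]
    by_cases h1 : (k, s) = b
    · rw [if_pos h1, if_pos h1, inner_productBasis]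
    · rw [if_neg h1, if_neg h1, inner_zero_right]
  rw [coe_ofOperator]
  simp only [h, ite_smul, one_smul, zero_smul]
  simp

theorem coe_ofOperator_one (hρ : IsDensityMatrix ρ) :
    (ofOperator hρ 1 : MaxTensor (BrownAlgebra n) (BrownAlgebra n)) = 1 := by
  rw [coe_ofOperator]
  simp only [one_apply_eq_self, inner_productBasis, ite_smul, one_smul, zero_smul,
    Finset.sum_ite_eq, Finset.mem_univ, if_true]
  rw [← map_sum, sum_weighted_self hρ, map_one]

/-- Positivity of $\Phi$: a positive matrix is a sum of rank-one matrices $(\bar c_a c_b)$, and each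
of these goes to a square. -/
theorem exists_ofOperator_star_mul_self (hρ : IsDensityMatrix ρ)
    (T : ProductOperators n) :
    ∃ y, (ofOperator hρ (star T * T) : MaxTensor (BrownAlgebra n) (BrownAlgebra n)) =
      star y * y := by
  obtain ⟨B, hB⟩ := exists_entries_of_posSemidef
    -- The entries $\langle e_a,T^*Te_b\rangle=\langle Te_a,Te_b\rangle$ form a Gram matrix; the
    -- rows of its factor `B` are the coefficient vectors $c$.
    (Matrix.posSemidef_gram (𝕜 := ℂ) fun a : Fin n × Fin n => T (productBasis a))
  choose y hy using fun q => exists_weighted_quadratic_eq (toMax _ _) hρ (B q)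
  obtain ⟨z, hz⟩ := exists_sum_star_mul_self Finset.univ y
  refine ⟨z, ?_⟩
  rw [← hz]
  simp only [← hy]
  rw [coe_ofOperator]
  symm
  refine Finset.sum_comm.trans (Finset.sum_congr rfl fun a _ => ?_)
  refine Finset.sum_comm.trans (Finset.sum_congr rfl fun b _ => ?_)
  rw [← Finset.sum_smul, ← hB, Matrix.gram_apply, mul_apply_eq_comp,
    ContinuousLinearMap.star_eq_adjoint, ContinuousLinearMap.adjoint_inner_right]

/-- Both sides are linear, so spanning elements suffice: $x_{jkrs}\mapsto E_{jk}\otimes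
E_{rs}\mapsto x_{jkrs}$ and $1\mapsto1\mapsto1$. This one-sided inverse gives injectivity of
`comparison` and lets states be transported back. -/
theorem ofOperator_comp_comparison (hρ : IsDensityMatrix ρ)
    {θ : MinTensor (BrownAlgebra n) (BrownAlgebra n) →⋆ₐ[ℂ] ProductOperators n}
    (hθ : ∀ j k r s, θ (toMin _ _ (weighted ρ j k r s)) =
      opTensor (matrixUnit j k) (matrixUnit r s)) (x : (Fqc hρ).toSubmodule) :
    ofOperator hρ (θ (comparison hρ x)) = x := by
  obtain ⟨x, hx⟩ := x
  refine Subtype.ext ?_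
  change (ofOperator hρ (θ (maxToMin _ _ x)) : MaxTensor (BrownAlgebra n) (BrownAlgebra n)) = x
  refine Submodule.span_induction
    (p := fun x _ => (ofOperator hρ (θ (maxToMin _ _ x)) :
      MaxTensor (BrownAlgebra n) (BrownAlgebra n)) = x) ?_ ?_ ?_ ?_ hx
  · rintro x (rfl | ⟨j, k, r, s, rfl⟩)
    · rw [map_one, map_one, coe_ofOperator_one]
    · rw [maxToMin_toMax, hθ, coe_ofOperator_matrixUnit]
  · simp only [map_zero, Submodule.coe_zero]
  · intro x y _ _ hx hy
    rw [map_add, map_add, map_add, Submodule.coe_add, hx, hy]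
  · intro c x _ hx
    rw [map_smul, map_smul, map_smul, Submodule.coe_smul, hx]

theorem comparison_surjective (hρ : IsDensityMatrix ρ) :
    Function.Surjective (comparison hρ) := by
  rintro ⟨y, hy⟩
  suffices h : ∃ x ∈ (Fqc hρ).toSubmodule, maxToMin _ _ x = y by
    obtain ⟨x, hx, rfl⟩ := h
    exact ⟨⟨x, hx⟩, rfl⟩
  refine Submodule.span_induction
    (p := fun y _ => ∃ x ∈ (Fqc hρ).toSubmodule, maxToMin _ _ x = y) ?_ ?_ ?_ ?_ hy
  · rintro y (rfl | ⟨j, k, r, s, rfl⟩)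
    · exact ⟨1, (Fqc hρ).one_mem', map_one _⟩
    · exact ⟨_, Submodule.subset_span (Or.inr ⟨j, k, r, s, rfl⟩), maxToMin_toMax _ _ _⟩
  · exact ⟨0, Submodule.zero_mem _, map_zero _⟩
  · rintro _ _ _ _ ⟨x, hx, rfl⟩ ⟨y, hy, rfl⟩
    exact ⟨x + y, Submodule.add_mem _ hx hy, map_add _ _ _⟩
  · rintro c _ _ ⟨x, hx, rfl⟩
    exact ⟨c • x, Submodule.smul_mem _ _ hx, map_smul _ _ _⟩

/-- A unital *-homomorphism sends squares to squares, so this direction uses nothing about the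
weighted elements. -/
theorem isState_comp_comparison (hρ : IsDensityMatrix ρ) {ψ : (Fqa hρ).toSubmodule →ₗ[ℂ] ℂ}
    (hψ : IsState (Fqa hρ) ψ) : IsState (Fqc hρ) (ψ ∘ₗ comparison hρ) where
  map_one := by
    refine Eq.trans (congrArg ψ (Subtype.ext ?_)) hψ.map_one
    exact map_one (maxToMin (BrownAlgebra n) (BrownAlgebra n))
  nonneg := by
    rintro x ⟨y, hy⟩
    refine hψ.nonneg _ ⟨maxToMin _ _ y, ?_⟩
    change maxToMin _ _ (x : MaxTensor (BrownAlgebra n) (BrownAlgebra n)) = _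
    rw [hy, map_mul, map_star]

/-- The substantial direction: an element positive in the minimal tensor product must be shown to
come from one positive in the maximal. Passing through the matrix algebra achieves this, with
$\psi=\varphi\circ\Phi\circ\theta$. -/
theorem exists_isState_comp_comparison_eq (hρ : IsDensityMatrix ρ)
    {φ : (Fqc hρ).toSubmodule →ₗ[ℂ] ℂ} (hφ : IsState (Fqc hρ) φ) :
    ∃ ψ, IsState (Fqa hρ) ψ ∧ ψ ∘ₗ comparison hρ = φ := by
  obtain ⟨θ, hθ⟩ := exists_minTensor_hom_weighted hρ
  refine ⟨φ ∘ₗ ofOperator hρ ∘ₗ θ.toAlgHom.toLinearMap ∘ₗ (Fqa hρ).toSubmodule.subtype,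
    ⟨?_, ?_⟩, LinearMap.ext fun x => congrArg φ (ofOperator_comp_comparison hρ hθ x)⟩
  · change φ (ofOperator hρ (θ 1)) = 1
    rw [map_one]
    exact (congrArg φ (Subtype.ext (coe_ofOperator_one hρ))).trans hφ.map_one
  · rintro x ⟨y, hy⟩
    change 0 ≤ φ (ofOperator hρ (θ x))
    refine hφ.nonneg _ ?_
    rw [hy, map_mul, map_star]
    -- The root `y` need not lie in the operator system; this is harmless because `θ` is defined on
    -- the whole C*-algebra.
    exact exists_ofOperator_star_mul_self hρ (θ y)

end Comparison

end BrownTsirelson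

theorem mainTheorem7 (n : ℕ) (hn : 2 ≤ n) (ρ : Matrix (Fin n × Fin n) (Fin n × Fin n) ℂ)
    (hρ : BrownTsirelson.IsDensityMatrix ρ) :
    Function.Bijective (BrownTsirelson.comparison hρ) ∧
      BrownTsirelson.stateSpace (BrownTsirelson.Fqc hρ) =
        (fun ψ => ψ ∘ₗ BrownTsirelson.comparison hρ) ''
          BrownTsirelson.stateSpace (BrownTsirelson.Fqa hρ) := by
  obtain ⟨θ, hθ⟩ := BrownTsirelson.exists_minTensor_hom_weighted hρ
  refine ⟨⟨?_, BrownTsirelson.comparison_surjective hρ⟩, Set.ext fun φ => ⟨fun hφ => ?_, ?_⟩⟩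
  · exact Function.LeftInverse.injective
      (g := fun y : (BrownTsirelson.Fqa hρ).toSubmodule => BrownTsirelson.ofOperator hρ (θ y))
      (BrownTsirelson.ofOperator_comp_comparison hρ hθ)
  · exact BrownTsirelson.exists_isState_comp_comparison_eq hρ hφ
  · rintro ⟨ψ, hψ, rfl⟩
    exact BrownTsirelson.isState_comp_comparison hρ hψ
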